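/- Let $M,m,l_F,\eta\ge 1$ be integers, $\mu=1/m$, $n_F=m\,l_F$, $l_S=m\,\eta$ (so $\mu=l_F/n_F$ and $\eta=\mu l_S$), and let $\alpha\in[0,1]$, $\beta>0$, $\gamma\ge 0$, $q\in[0,1]$, $P_B,P_U\ge 0$, $P_c>0$. Put $\lambda=\sqrt{P_c/(P_B(1+2\alpha^2)+1)}$. In one minislot, $M$ edge nodes receive, on the frequency channels $f=1,\dots,n_F$ and with cell indices taken modulo $M$, $$Y_k^f=X_k^f+\alpha X_{k-1}^f+\alpha X_{k+1}^f+\beta A_kU_k^f+Z_k^f ,$$ where the eMBB symbols $X_k^f$ are i.i.d. $\mathcal{CN}(0,P_B)$, the URLLC symbols $U_k^f$ are i.i.d. $\mathcal{CN}(0,P_U)$, the noise samples $Z_k^f$ are i.i.d. $\mathcal{CN}(0,1)$, the activities $A_k\in\{0,1\}$ are i.i.d. Bernoulli$(q)$, and all of these are independent. Node $k$ splits $(Y_k^1,\dots,Y_k^{n_F})$ into $m$ consecutive blocks of length $l_F$, the columns of an $l_F\times m$ matrix $\mathbf Y_k$, and sends $\lambda(\mathbf Y_k\otimes\mathbf 1_\eta^T)$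 over a cable with channel $\mathbf H_c=\gamma\mathbf 1_{l_S}\mathbf 1_{l_S}^T+(1-\gamma)\mathbf I_{l_S}$ and noise $\tilde{\mathbf W}_k$ with independent i.i.d. $\mathcal{CN}(0,1)$ entries. The BBU forms $$\mathbf R_k=\lambda^{-1}\big(\lambda(\mathbf Y_k\otimes\mathbf 1_\eta^T)\mathbf H_c+\tilde{\mathbf W}_k\big)\mathbf G,\qquad \mathbf G=\tfrac1\eta(\mathbf I_m\otimes\mathbf 1_\eta).$$ Let $\mathbf r$ and $\mathbf x$ be the vectors of all entries of $\mathbf R_1,\dots,\mathbf R_M$ and of all $X_k^f$, in the same order (cell, block, position in the block), and let $\mathbf A=\mathrm{diag}(A_1,\dots,A_M)$. The per-user eMBB rate under NOMA, when the BBU decodes jointly, knows $\mathbf A$ and treats the URLLC interference as noise, is $$R_B=\frac{1}{n_FM}\,I(\mathbf r;\mathbf x\mid\mathbf A)$$ (in bits, all logarithms to base 2). Let $\mathbf H$ be the $M\times M$ circulant matrix with first column $[1,\alpha,0,\dots,0,\alpha]^T$ (for $M\le 2$ coinciding entries are added), $\mathbf H_c^\eta=\gamma\eta\mathbf 1_m\mathbf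 1_m^T+(1-\gamma)\mathbf I_m$, $\mathbf H_{\rm eq}=\mathbf H\otimes\mathbf H_c^\eta$, $$\mathbf R_{z_{\rm eq}}=\mathbf I_M\otimes\mathbf H_c^\eta\mathbf H_c^\eta+\frac{1}{\lambda^2\eta}\mathbf I_{Mm},\qquad \mathbf R_{A,z_{\rm eq}}=\mathbf R_{z_{\rm eq}}+\beta^2P_U\,(\mathbf A\otimes\mathbf H_c^\eta\mathbf H_c^\eta).$$ Then $\mathbf R_{A,z_{\rm eq}}$ is invertible and the determinant below is positive for every value of $\mathbf A$; given $\mathbf A$, the noise plus URLLC interference contained in $\mathbf r$ (the value of $\mathbf r$ when all $X_k^f$ are replaced by $0$) is centred with covariance $\mathbf R_{A,z_{\rm eq}}\otimes\mathbf I_{l_F}$; and $R_B$ is finite with $$R_B=\frac{\mu}{M}\,\mathbb E_{\mathbf A}\Big[\log_2\det\big(\mathbf I+P_B\,\mathbf R_{A,z_{\rm eq}}^{-1}\mathbf H_{\rm eq}\mathbf H_{\rm eq}^T\big)\Big].$$ -/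

import Mathlib

open MeasureTheory ProbabilityTheory
open scoped Kronecker NNReal ENNReal

noncomputable section

/-! ### Information measures -/

/-- Mutual information (in nats) between the random elements `X` and `Y`: the Kullback-Leibler
divergence of the joint law from the product of the marginal laws. -/
def mutualInfo {Ω E F : Type*} [MeasurableSpace Ω] [MeasurableSpace E] [MeasurableSpace F]
    (P : Measure Ω) (X : Ω → E) (Y : Ω → F) : ℝ≥0∞ :=
  InformationTheory.klDiv (P.map fun ω => (X ω, Y ω)) ((P.map X).prod (P.map Y))

/-- Conditional mutual information `I(X; Y | A)` (in nats) given a random element `A` with finitely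
many values: the average over `a` of the mutual information under the conditional probability
given `A = a`. -/
def condMutualInfo {Ω E F T : Type*} [MeasurableSpace Ω] [MeasurableSpace E] [MeasurableSpace F]
    [Fintype T] (P : Measure Ω) (X : Ω → E) (Y : Ω → F) (A : Ω → T) : ℝ≥0∞ :=
  ∑ a, P (A ⁻¹' {a}) * mutualInfo (cond P (A ⁻¹' {a})) X Y

/-- The circularly symmetric complex Gaussian law `CN(0, v)`: independent real and imaginary parts,
each `N(0, v / 2)`. -/
def complexGaussian (v : ℝ≥0) : Measure ℂ :=
  ((gaussianReal 0 (v / 2)).prod (gaussianReal 0 (v / 2))).map fun p => (⟨p.1, p.2⟩ : ℂ)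

/-! ### The network -/

/-- The scalar parameters of the C-RAN uplink. -/
structure CRAN where
  /-- inter-cell eMBB channel gain -/
  α : ℝ
  /-- URLLC channel gain -/
  β : ℝ
  /-- coupling (crosstalk) coefficient between the pairs of a cable -/
  γ : ℝ
  /-- eMBB power -/
  PB : ℝ≥0
  /-- URLLC power -/
  PU : ℝ≥0
  /-- cable power -/
  Pc : ℝ≥0
  /-- URLLC activity probability -/
  q : unitInterval
  α_mem : α ∈ Set.Icc (0 : ℝ) 1
  β_pos : 0 < β
  γ_nonneg : 0 ≤ γ
  Pc_pos : 0 < Pc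

/-! There are `M` cells. With `m = 1 / μ`, the radio band has `nF = m * lF` frequency channels,
split into `m` blocks of `lF` channels, and each cable has `lS = m * η` pairs. -/

/-- A radio resource `((k, j), i)`: cell `k` and frequency channel `i` of the block `j`. -/
abbrev Res (M m lF : ℕ) := (Fin M × Fin m) × Fin lF

/-- A cable resource `((k, (j, e)), i)`: cable of cell `k`, pair `(j, e)` (the `e`-th of the `η`
pairs that carry the block `j`), cable frequency `i`. -/
abbrev CableRes (M m lF η : ℕ) := (Fin M × (Fin m × Fin η)) × Fin lF

/-- The vectorization of an `nF × M` complex matrix. -/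
abbrev Signal (M m lF : ℕ) := Res M m lF → ℂ

/-- The vectorized cable noise of all `M` cables. -/
abbrev CableNoise (M m lF η : ℕ) := CableRes M m lF η → ℂ

/-- The activity pattern of the URLLC users. -/
abbrev Activity (M : ℕ) := Fin M → Bool

/-- The number `nF` of radio frequency channels. -/
def nF (m lF : ℕ) : ℕ := m * lF

/-- The normalized cable bandwidth `μ = lF / nF`. -/
def mu (m lF : ℕ) : ℝ := (lF : ℝ) / (nF m lF : ℝ)

namespace CRAN

variable (N : CRAN) {M m lF η : ℕ}

/-- The signal received at the edge nodes under NOMA; cell indices are cyclic. -/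
def radio [NeZero M] (a : Activity M) (x u z : Signal M m lF) : Signal M m lF :=
  fun ((k, j), i) =>
    x ((k, j), i) + (N.α : ℂ) * x ((k - 1, j), i) + (N.α : ℂ) * x ((k + 1, j), i)
      + (N.β : ℂ) * (if a k then 1 else 0) * u ((k, j), i) + z ((k, j), i)

/-- The fronthaul scaling factor `λ` under NOMA. -/
def scaling : ℝ := √((N.Pc : ℝ) / ((N.PB : ℝ) * (1 + 2 * N.α ^ 2) + 1))

/-- The cable channel `H_c = γ 1 1ᵀ + (1 - γ) I` among the `lS = m * η` pairs. -/
def cableChannel : Matrix (Fin m × Fin η) (Fin m × Fin η) ℝ :=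
  N.γ • Matrix.of (fun _ _ => 1) + (1 - N.γ) • 1

/-- The `lF × lS` matrix that node `k` maps on its cable: block `j` of the radio signal is
replicated over the `η` pairs `(j, e)`. -/
def cableInput (y : Signal M m lF) (k : Fin M) : Matrix (Fin lF) (Fin m × Fin η) ℂ :=
  Matrix.of fun i p => y ((k, p.1), i)

/-- The maximum ratio combiner `G = η⁻¹ (I ⊗ 1_η)`, an `lS × m` matrix. -/
def combiner : Matrix (Fin m × Fin η) (Fin m) ℝ :=
  Matrix.of fun p j => if p.1 = j then (η : ℝ)⁻¹ else 0

/-- The `lF × lS` matrix at the output of the cable of cell `k`: the cable input is amplified by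
`λ`, then the cable channel and the cable noise act on it. -/
def cableOutput (y : Signal M m lF) (w : CableNoise M m lF η) (k : Fin M) :
    Matrix (Fin lF) (Fin m × Fin η) ℂ :=
  Matrix.of fun i p =>
    ∑ p', (N.scaling : ℂ) * cableInput (η := η) y k i p' * (N.cableChannel p' p : ℂ) + w ((k, p), i)

/-- The signal available at the BBU: the cable outputs are combined by `G`, and the gain `λ` is
removed. -/
def bbu (y : Signal M m lF) (w : CableNoise M m lF η) : Signal M m lF :=
  fun ((k, j), i) =>
    (N.scaling : ℂ)⁻¹ * ∑ p, N.cableOutput y w k i p * ((combiner (m := m) (η := η) p j : ℝ) : ℂ)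

/-- The law of the activity pattern: independent Bernoulli variables of parameter `q`. -/
def activityLaw (M : ℕ) : Measure (Activity M) :=
  Measure.pi fun _ => bernoulliMeasure true false N.q

/-- Sample space of one minislot: activity pattern, eMBB signal, URLLC signal, radio noise,
cable noise. -/
abbrev Sample (M m lF η : ℕ) :=
  Activity M × Signal M m lF × Signal M m lF × Signal M m lF × CableNoise M m lF η

/-- The law of one minislot: everything is independent, the signals of the eMBB and of the URLLC
users have i.i.d. entries `CN(0, PB)` and `CN(0, PU)`, both noises have i.i.d. entries
`CN(0, 1)`. -/
def law (M m lF η : ℕ) : Measure (Sample M m lF η) :=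
  (N.activityLaw M).prod <|
    (Measure.pi fun _ => complexGaussian N.PB).prod <|
      (Measure.pi fun _ => complexGaussian N.PU).prod <|
        (Measure.pi fun _ => complexGaussian 1).prod (Measure.pi fun _ => complexGaussian 1)

/-- The activity pattern `A`. -/
def activity (s : Sample M m lF η) : Activity M := s.1

/-- The eMBB signal `x`. -/
def embb (s : Sample M m lF η) : Signal M m lF := s.2.1

/-- The signal `r` available at the BBU. -/
def received [NeZero M] (s : Sample M m lF η) : Signal M m lF :=
  N.bbu (N.radio s.1 s.2.1 s.2.2.1 s.2.2.2.1) s.2.2.2.2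

/-- The noise plus URLLC interference in the signal available at the BBU: what is received there
when the eMBB signal is zero. -/
def interference [NeZero M] (s : Sample M m lF η) : Signal M m lF :=
  N.bbu (N.radio s.1 0 s.2.2.1 s.2.2.2.1) s.2.2.2.2

/-- The per-user eMBB rate, in bits per radio resource, of joint decoding at a BBU that knows the
activity pattern and treats the URLLC signals as noise: `I(r; x | A) / (nF M)`. -/
def rate (M m lF η : ℕ) [NeZero M] : ℝ≥0∞ :=
  condMutualInfo (N.law M m lF η) N.received embb activity
    / ENNReal.ofReal (Real.log 2) / ((nF m lF : ℝ≥0∞) * (M : ℝ≥0∞))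

/-! ### The matrices of the rate formula -/

/-- The `M × M` radio channel matrix: circulant with first column `(1, α, 0, …, 0, α)`. -/
def H (M : ℕ) [NeZero M] : Matrix (Fin M) (Fin M) ℝ :=
  Matrix.circulant (Pi.single 0 1 + Pi.single 1 N.α + Pi.single (-1) N.α)

/-- The equivalent fronthaul channel `γ η 1 1ᵀ + (1 - γ) I`, an `m × m` matrix. -/
def Hc (m η : ℕ) : Matrix (Fin m) (Fin m) ℝ :=
  (N.γ * η) • Matrix.of (fun _ _ => 1) + (1 - N.γ) • 1

/-- The overall channel `H ⊗ H_c^η`. -/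
def Heq (M m η : ℕ) [NeZero M] : Matrix (Fin M × Fin m) (Fin M × Fin m) ℝ :=
  N.H M ⊗ₖ N.Hc m η

/-- The noise covariance without URLLC interference. -/
def Rz (M m η : ℕ) : Matrix (Fin M × Fin m) (Fin M × Fin m) ℝ :=
  (1 : Matrix (Fin M) (Fin M) ℝ) ⊗ₖ (N.Hc m η * N.Hc m η) + (1 / (N.scaling ^ 2 * η)) • 1

/-- The diagonal 0-1 matrix of an activity pattern. -/
def activityMatrix (a : Activity M) : Matrix (Fin M) (Fin M) ℝ :=
  Matrix.diagonal fun k => if a k then 1 else 0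

/-- The covariance of the noise plus URLLC interference for a given activity pattern. -/
def RA (m η : ℕ) (a : Activity M) : Matrix (Fin M × Fin m) (Fin M × Fin m) ℝ :=
  N.Rz M m η + (N.β ^ 2 * N.PU) • (activityMatrix a ⊗ₖ (N.Hc m η * N.Hc m η))

/-- The matrix `I + P_B R⁻¹ H_eq H_eqᵀ` whose log-determinant is averaged. -/
def gainMatrix [NeZero M] (m η : ℕ) (a : Activity M) :
    Matrix (Fin M × Fin m) (Fin M × Fin m) ℝ :=
  1 + (N.PB : ℝ) • ((N.RA m η a)⁻¹ * N.Heq M m η * (N.Heq M m η).transpose)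

end CRAN

end

/-! Fix an activity pattern `a`. Replication, crosstalk and combining are all linear, so the BBU
sees r = T x + n with T = `Heq` ⊗ I real, and n a linear image of the URLLC signal and the two
noises, hence independent of x. Therefore n and r are centred complex normal, with covariances R_A ⊗
I and (R_A + P_B H_eq H_eqᵀ) ⊗ I. The cable noise contributes a positive multiple of the identity to
R_A, so both covariances are positive definite.

The mutual information of an additive noise channel is h(r) − h(n) (`klDiv_map_additive_noise`). For
complex normal laws of equal dimension the terms n log π + n cancel, which leaves the logarithm of a
ratio of determinants (`IsComplexNormal.klDiv_map`). The factor I of size lF raises this ratio to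
the power lF, and the ratio is the determinant of `gainMatrix` (`det_gainMatrix`). Averaging over
`a` and normalizing gives the rate.

Powers may vanish, so x and separate terms of n can be degenerate. Complex normal laws are therefore
handled by characteristic functions, which behave well under linear maps and independent sums
whether or not a density exists. Only the total noise and the output need densities f and g: the
joint law of (r, x) has density f(r − T x) / g(r) against the product of its marginals, whatever the
law of x. Moments, densities and entropies follow by writing the law as the image of i.i.d. `CN(0,
1)` entries under B, where R = B Bᵀ. -/

open Matrix in
/-- The measure `μ` on `ι → ℂ` is the centred circularly symmetric complex Gaussian law with
covariance matrix `S`, expressed through its characteristic function. -/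
def IsComplexNormal {ι : Type*} [Fintype ι] (μ : Measure (ι → ℂ)) (S : Matrix ι ι ℂ) : Prop :=
  ∀ t : ι → ℂ, ∫ z, Complex.exp (Complex.I * ((star t ⬝ᵥ z).re : ℂ)) ∂μ
    = Complex.exp (-(star t ⬝ᵥ S *ᵥ t) / 4)

/-! ### Characteristic function of the scalar complex Gaussian law. -/

instance complexGaussian.instIsProbabilityMeasure (v : ℝ≥0) :
    IsProbabilityMeasure (complexGaussian v) :=
  Measure.isProbabilityMeasure_map Complex.measurableEquivRealProd.symm.measurable.aemeasurable

lemma complexGaussian_eq_map (v : ℝ≥0) :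
    complexGaussian v = ((gaussianReal 0 (v / 2)).prod (gaussianReal 0 (v / 2))).map
      Complex.measurableEquivRealProd.symm := rfl

lemma integral_exp_gaussianReal_zero (v : ℝ≥0) (s : ℝ) :
    ∫ x, Complex.exp (s * x * Complex.I) ∂(gaussianReal 0 v) = Complex.exp (-(v * s ^ 2 / 2)) := by
  have h := charFun_gaussianReal (μ := 0) (v := v) s
  rw [charFun_apply_real] at h
  rw [h]
  simp

/-- The real pairing is `t.re * x + t.im * y` with independent coordinates of variance v/2 each;
this halved variance is why `IsComplexNormal` divides by 4 and not by 2. -/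
lemma integral_exp_complexGaussian (v : ℝ≥0) (t : ℂ) :
    ∫ z, Complex.exp (Complex.I * ((star t * z).re : ℂ)) ∂(complexGaussian v)
      = Complex.exp (-(v * (star t * t)) / 4) := by
  rw [complexGaussian_eq_map, integral_map_equiv]
  have h : ∀ p : ℝ × ℝ, Complex.exp (Complex.I *
      ((star t * Complex.measurableEquivRealProd.symm p).re : ℂ))
      = Complex.exp (t.re * p.1 * Complex.I) * Complex.exp (t.im * p.2 * Complex.I) := by
    intro p
    rw [← Complex.exp_add]
    congr 1
    simp [Complex.measurableEquivRealProd]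
    ring
  simp_rw [h]
  rw [integral_prod_mul (fun x : ℝ => Complex.exp (t.re * x * Complex.I))
    (fun x : ℝ => Complex.exp (t.im * x * Complex.I)), integral_exp_gaussianReal_zero,
    integral_exp_gaussianReal_zero, ← Complex.exp_add]
  congr 1
  have : star t * t = (t.re : ℂ) ^ 2 + (t.im : ℂ) ^ 2 := by
    rw [Complex.star_def, mul_comm, Complex.mul_conj, Complex.normSq_apply]
    push_cast
    ring
  rw [this]
  push_cast
  ring

/-! ### Complex normal vectors: linear images, independent sums, uniqueness. -/

section IsComplexNormal

open Matrix

variable {ι κ : Type*} [Fintype ι] [Fintype κ]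

lemma isComplexNormal_pi_complexGaussian [DecidableEq ι] (v : ℝ≥0) :
    IsComplexNormal (Measure.pi fun _ : ι => complexGaussian v) ((v : ℂ) • 1) := by
  intro t
  have h : ∀ z : ι → ℂ, Complex.exp (Complex.I * ((star t ⬝ᵥ z).re : ℂ))
      = ∏ i, Complex.exp (Complex.I * ((star (t i) * z i).re : ℂ)) := by
    intro z
    rw [← Complex.exp_sum, ← Finset.mul_sum, dotProduct, Complex.re_sum]
    simp
  simp_rw [h]
  rw [integral_fintype_prod_eq_prod
    (fun i (z : ℂ) => Complex.exp (Complex.I * ((star (t i) * z).re : ℂ)))]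
  simp_rw [integral_exp_complexGaussian]
  rw [← Complex.exp_sum]
  congr 1
  simp only [smul_mulVec, one_mulVec, dotProduct, Pi.smul_apply, Pi.star_apply, smul_eq_mul]
  rw [← Finset.sum_neg_distrib, Finset.sum_div]
  exact Finset.sum_congr rfl fun i _ => by ring

lemma measurable_mulVec (C : Matrix κ ι ℂ) : Measurable (C *ᵥ · : (ι → ℂ) → κ → ℂ) :=
  (Continuous.matrix_mulVec continuous_const continuous_id).measurable

lemma IsComplexNormal.map_mulVec {μ : Measure (ι → ℂ)} {S : Matrix ι ι ℂ}
    (h : IsComplexNormal μ S) (C : Matrix κ ι ℂ) :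
    IsComplexNormal (μ.map (C *ᵥ ·)) (C * S * Cᴴ) := by
  intro t
  rw [integral_map (measurable_mulVec C).aemeasurable]
  · have e : ∀ z, star t ⬝ᵥ C *ᵥ z = star (Cᴴ *ᵥ t) ⬝ᵥ z := by
      intro z
      rw [star_mulVec, conjTranspose_conjTranspose, dotProduct_mulVec]
    simp_rw [e]
    rw [h, ← e, mulVec_mulVec, mulVec_mulVec]
  · refine Continuous.aestronglyMeasurable ?_
    unfold dotProduct
    fun_prop

lemma IsComplexNormal.map_add {Ω Ω' : Type*} [MeasurableSpace Ω] [MeasurableSpace Ω']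
    {μ : Measure Ω} {ν : Measure Ω'} [SFinite μ] [SFinite ν] {f : Ω → ι → ℂ} {g : Ω' → ι → ℂ}
    {S S' : Matrix ι ι ℂ} (hf : Measurable f) (hg : Measurable g)
    (h : IsComplexNormal (μ.map f) S) (h' : IsComplexNormal (ν.map g) S') :
    IsComplexNormal ((μ.prod ν).map fun p => f p.1 + g p.2) (S + S') := by
  intro t
  have hc : Continuous fun z : ι → ℂ => Complex.exp (Complex.I * ((star t ⬝ᵥ z).re : ℂ)) := by
    unfold dotProduct
    fun_prop
  have h1 := h t
  have h2 := h' t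
  rw [integral_map hf.aemeasurable hc.aestronglyMeasurable] at h1
  rw [integral_map hg.aemeasurable hc.aestronglyMeasurable] at h2
  rw [integral_map (by fun_prop) hc.aestronglyMeasurable]
  simp_rw [dotProduct_add, Complex.add_re, Complex.ofReal_add, mul_add, Complex.exp_add]
  rw [integral_prod_mul (fun x => Complex.exp (Complex.I * ((star t ⬝ᵥ f x).re : ℂ)))
    (fun x => Complex.exp (Complex.I * ((star t ⬝ᵥ g x).re : ℂ))), h1, h2, ← Complex.exp_add,
    add_mulVec, dotProduct_add]
  congr 1
  ring

/-- A real functional has two real coefficients per complex coordinate, its values at 1 and at i.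
Hence the test functions in `IsComplexNormal` exhaust the real dual, and they determine the measure.
-/
lemma exists_dual_eq_re_dotProduct (L : StrongDual ℝ (ι → ℂ)) :
    ∃ t : ι → ℂ, ∀ z, L z = (star t ⬝ᵥ z).re := by
  classical
  refine ⟨fun i => ⟨L (Pi.single i 1), L (Pi.single i Complex.I)⟩, fun z => ?_⟩
  have hz : z = ∑ i, ((z i).re • (Pi.single i 1 : ι → ℂ)
      + (z i).im • (Pi.single i Complex.I : ι → ℂ)) := by
    ext j
    simp only [Finset.sum_apply, Pi.add_apply, Pi.smul_apply]
    rw [Finset.sum_eq_single j]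
    · simp
    · intro b _ hb
      simp [hb.symm]
    · simp
  conv_lhs => rw [hz]
  simp only [map_sum, map_add, map_smul, dotProduct, Complex.re_sum, smul_eq_mul]
  refine Finset.sum_congr rfl fun i _ => ?_
  simp
  ring

lemma IsComplexNormal.ext {μ ν : Measure (ι → ℂ)} [IsFiniteMeasure μ] [IsFiniteMeasure ν]
    {S : Matrix ι ι ℂ} (h : IsComplexNormal μ S) (h' : IsComplexNormal ν S) : μ = ν := by
  refine Measure.ext_of_charFunDual ?_
  ext L
  obtain ⟨t, ht⟩ := exists_dual_eq_re_dotProduct L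
  simp only [charFunDual_apply, ht]
  have h1 := h t
  have h2 := h' t
  simp_rw [mul_comm Complex.I] at h1 h2
  rw [h1, h2]

end IsComplexNormal

/-! ### First and second moments of Gaussian vectors with independent entries. -/

section Moments

open Matrix

lemma memLp_complexGaussian (v : ℝ≥0) : MemLp (fun z : ℂ => z) 2 (complexGaussian v) := by
  rw [← memLp_re_im_iff, complexGaussian_eq_map]
  have h := memLp_id_gaussianReal' (μ := 0) (v := v / 2) 2 (by simp)
  constructor
  · rw [MeasurableEquiv.memLp_map_measure_iff]
    exact h.comp_fst _
  · rw [MeasurableEquiv.memLp_map_measure_iff]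
    exact h.comp_snd _

lemma integral_complexGaussian (v : ℝ≥0) : ∫ z, z ∂(complexGaussian v) = 0 := by
  have hi : Integrable (fun z : ℂ => z) (complexGaussian v) :=
    (memLp_complexGaussian v).integrable (by simp)
  have h1 : ∫ z, z.re ∂(complexGaussian v) = 0 := by
    rw [complexGaussian_eq_map, integral_map_equiv]
    change ∫ p : ℝ × ℝ, p.1 ∂_ = 0
    rw [integral_fun_fst (fun x : ℝ => x)]
    simp
  have h2 : ∫ z, z.im ∂(complexGaussian v) = 0 := by
    rw [complexGaussian_eq_map, integral_map_equiv]
    change ∫ p : ℝ × ℝ, p.2 ∂_ = 0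
    rw [integral_fun_snd (fun x : ℝ => x)]
    simp
  rw [← integral_re_add_im hi]
  simp only [RCLike.re_eq_complex_re, RCLike.im_eq_complex_im]
  rw [h1, h2]
  simp

lemma integral_sq_gaussianReal_zero (v : ℝ≥0) : ∫ x, x ^ 2 ∂(gaussianReal 0 v) = v := by
  have h := variance_fun_id_gaussianReal (μ := 0) (v := v)
  rwa [variance_of_integral_eq_zero (by fun_prop) (by simp)] at h

lemma integral_normSq_complexGaussian (v : ℝ≥0) :
    Integrable Complex.normSq (complexGaussian v) ∧
      ∫ z, Complex.normSq z ∂(complexGaussian v) = v := by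
  have h := (memLp_id_gaussianReal' (μ := 0) (v := v / 2) 2 (by simp)).integrable_sq
  have h1 : Integrable (fun p : ℝ × ℝ => p.1 ^ 2)
    ((gaussianReal 0 (v / 2)).prod (gaussianReal 0 (v / 2))) := h.comp_fst _
  have h2 : Integrable (fun p : ℝ × ℝ => p.2 ^ 2)
    ((gaussianReal 0 (v / 2)).prod (gaussianReal 0 (v / 2))) := h.comp_snd _
  have e : (fun p : ℝ × ℝ => Complex.normSq (Complex.measurableEquivRealProd.symm p))
      = fun p => p.1 ^ 2 + p.2 ^ 2 := by
    ext p
    simp [Complex.measurableEquivRealProd, Complex.normSq_apply]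
    ring
  rw [complexGaussian_eq_map, integral_map_equiv, integrable_map_equiv, Function.comp_def, e]
  refine ⟨h1.add h2, ?_⟩
  rw [integral_add h1 h2, integral_fun_fst (fun x : ℝ => x ^ 2),
    integral_fun_snd (fun x : ℝ => x ^ 2), integral_sq_gaussianReal_zero]
  simp

variable {ι κ : Type*} [Fintype ι]

lemma integral_mul_star_pi_complexGaussian [DecidableEq ι] (v : ℝ≥0) (i j : ι) :
    Integrable (fun g : ι → ℂ => g i * star (g j)) (Measure.pi fun _ => complexGaussian v) ∧
    ∫ g : ι → ℂ, g i * star (g j) ∂(Measure.pi fun _ => complexGaussian v)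
      = if i = j then (v : ℂ) else 0 := by
  have hi : Integrable (fun z : ℂ => z) (complexGaussian v) :=
    (memLp_complexGaussian v).integrable (by simp)
  split_ifs with h
  · subst h
    have e : (fun g : ι → ℂ => g i * star (g i)) = fun g => (fun z => (Complex.normSq z : ℂ)) (g i) := by
      ext g
      exact Complex.mul_conj _
    have h' := integral_normSq_complexGaussian v
    rw [e]
    refine ⟨integrable_comp_eval (μ := fun _ => complexGaussian v)
      (f := fun z => (Complex.normSq z : ℂ)) h'.1.ofReal, ?_⟩
    rw [integral_comp_eval (μ := fun _ => complexGaussian v) (f := fun z => (Complex.normSq z : ℂ))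
      h'.1.ofReal.aestronglyMeasurable, integral_complex_ofReal, h'.2]
  · have hind : IndepFun (fun g : ι → ℂ => g i) (fun g => star (g j))
        (Measure.pi fun _ => complexGaussian v) :=
      ((iIndepFun_pi (μ := fun _ : ι => complexGaussian v) (X := fun _ (z : ℂ) => z)
        (fun _ => aemeasurable_id')).indepFun h).comp measurable_id
          (continuous_star.measurable : Measurable (star : ℂ → ℂ))
    have h1 : Integrable (fun g : ι → ℂ => g i) (Measure.pi fun _ => complexGaussian v) :=
      integrable_comp_eval (μ := fun _ => complexGaussian v) hi
    have h2 : Integrable (fun g : ι → ℂ => star (g j)) (Measure.pi fun _ => complexGaussian v) :=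
      (LinearIsometryEquiv.integrable_comp_iff Complex.conjLIE).2
        (integrable_comp_eval (μ := fun _ => complexGaussian v) hi)
    refine ⟨hind.integrable_mul h1 h2, ?_⟩
    have := hind.integral_mul_eq_mul_integral h1.aestronglyMeasurable h2.aestronglyMeasurable
    rw [integral_comp_eval (μ := fun _ => complexGaussian v) hi.aestronglyMeasurable,
      integral_complexGaussian, zero_mul] at this
    exact this

lemma integral_mulVec_pi_complexGaussian (C : Matrix κ ι ℂ) (r s : κ) :
    ∫ g, (C *ᵥ g) r ∂(Measure.pi fun _ => complexGaussian 1) = 0 ∧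
    Integrable (fun g => (C *ᵥ g) r * star ((C *ᵥ g) s)) (Measure.pi fun _ => complexGaussian 1) ∧
    ∫ g, (C *ᵥ g) r * star ((C *ᵥ g) s) ∂(Measure.pi fun _ => complexGaussian 1)
      = (C * Cᴴ) r s := by
  classical
  have hi : Integrable (fun z : ℂ => z) (complexGaussian 1) :=
    (memLp_complexGaussian 1).integrable (by simp)
  have e : (fun g : ι → ℂ => (C *ᵥ g) r * star ((C *ᵥ g) s))
      = fun g => ∑ i, ∑ j, (C r i * star (C s j)) * (g i * star (g j)) := by
    ext g
    simp only [mulVec, dotProduct, star_sum, Finset.sum_mul_sum, star_mul']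
    refine Finset.sum_congr rfl fun i _ => Finset.sum_congr rfl fun j _ => ?_
    ring
  have hij := fun i j : ι => integral_mul_star_pi_complexGaussian 1 i j
  refine ⟨?_, ?_, ?_⟩
  · simp only [mulVec, dotProduct]
    rw [integral_finsetSum _ fun i _ =>
      (integrable_comp_eval (μ := fun _ : ι => complexGaussian 1) (i := i) hi).const_mul (C r i)]
    refine Finset.sum_eq_zero fun i _ => ?_
    rw [integral_const_mul, integral_comp_eval (μ := fun _ : ι => complexGaussian 1)
      hi.aestronglyMeasurable, integral_complexGaussian, mul_zero]
  · rw [e]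
    exact integrable_finsetSum _ fun i _ => integrable_finsetSum _ fun j _ =>
      (hij i j).1.const_mul _
  · rw [e, integral_finsetSum _ fun i _ => integrable_finsetSum _ fun j _ =>
      (hij i j).1.const_mul _]
    rw [mul_apply]
    refine Finset.sum_congr rfl fun i _ => ?_
    rw [integral_finsetSum _ fun j _ => (hij i j).1.const_mul _]
    simp_rw [integral_const_mul, (hij i _).2]
    simp [conjTranspose_apply]

end Moments

/-! ### Complex normal laws as linear images of the standard one. -/

section Representation

open Matrix

variable {ι : Type*} [Fintype ι] [DecidableEq ι]

open scoped MatrixOrder in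
lemma Matrix.PosDef.exists_isUnit_det_mul_transpose {R : Matrix ι ι ℝ} (hR : R.PosDef) :
    ∃ B : Matrix ι ι ℝ, IsUnit B.det ∧ R = B * Bᵀ := by
  obtain ⟨y, hy, h⟩ := CStarAlgebra.isStrictlyPositive_iff_eq_star_mul_self.mp
    hR.isStrictlyPositive
  -- The C⋆-algebraic factorization has the form `star y * y`; transposing `y` puts the factors in
  -- the order of a covariance.
  refine ⟨yᵀ, ?_, ?_⟩
  · rw [det_transpose]
    exact (isUnit_iff_isUnit_det _).1 hy
  · rw [h, transpose_transpose, star_eq_conjTranspose, conjTranspose_eq_transpose_of_trivial]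

/-- Both sides have the same characteristic function. This moves every computation to independent
standard coordinates. -/
lemma IsComplexNormal.eq_map_mulVec {μ : Measure (ι → ℂ)} [IsFiniteMeasure μ]
    {S B : Matrix ι ι ℂ} (h : IsComplexNormal μ S) (hS : S = B * Bᴴ) :
    μ = (Measure.pi fun _ => complexGaussian 1).map (B *ᵥ ·) := by
  refine h.ext ?_
  have := (isComplexNormal_pi_complexGaussian (ι := ι) 1).map_mulVec B
  simpa [hS] using this

omit [DecidableEq ι] in
lemma map_ofReal_mul_transpose {κ : Type*} [Fintype κ] (B : Matrix κ ι ℝ) :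
    (B * Bᵀ).map ((↑) : ℝ → ℂ)
      = B.map ((↑) : ℝ → ℂ) * (B.map ((↑) : ℝ → ℂ))ᴴ := by
  have : (B.map ((↑) : ℝ → ℂ))ᴴ = Bᵀ.map ((↑) : ℝ → ℂ) := by
    ext i j
    simp
  rw [this]
  ext i j
  simp [mul_apply]

/-- The first two moments of a centred complex normal law. -/
lemma IsComplexNormal.integral_mul_star {μ : Measure (ι → ℂ)} [IsFiniteMeasure μ]
    {R : Matrix ι ι ℝ} (hR : R.PosDef) (h : IsComplexNormal μ (R.map ((↑) : ℝ → ℂ))) (r s : ι) :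
    ∫ z, z r ∂μ = 0 ∧ Integrable (fun z => z r * star (z s)) μ ∧
      ∫ z, z r * star (z s) ∂μ = (R r s : ℂ) := by
  obtain ⟨B, -, rfl⟩ := hR.exists_isUnit_det_mul_transpose
  have hB := map_ofReal_mul_transpose B
  have hm := measurable_mulVec (B.map ((↑) : ℝ → ℂ))
  obtain ⟨h1, h2, h3⟩ := integral_mulVec_pi_complexGaussian (B.map ((↑) : ℝ → ℂ)) r s
  have hc : Continuous fun z : ι → ℂ => z r * star (z s) := by fun_prop
  rw [h.eq_map_mulVec hB]
  refine ⟨?_, ?_, ?_⟩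
  · rwa [integral_map hm.aemeasurable (continuous_apply r).aestronglyMeasurable]
  · rwa [integrable_map_measure hc.aestronglyMeasurable hm.aemeasurable]
  · rw [integral_map hm.aemeasurable hc.aestronglyMeasurable, h3, ← hB]
    rfl

end Representation

/-! ### Densities and differential entropy. -/

section Density

open Matrix

variable {ι : Type*} [Fintype ι]

/-- It suffices to compare the measures on boxes, where the integral of the product factors. -/
lemma pi_withDensity_ofReal {α : Type*} [MeasurableSpace α] (μ : Measure α) [SigmaFinite μ]
    {f : α → ℝ} (hf : Integrable f μ) (h0 : ∀ x, 0 ≤ f x) :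
    (Measure.pi fun _ : ι => μ.withDensity fun x => ENNReal.ofReal (f x))
      = (Measure.pi fun _ : ι => μ).withDensity fun x => ENNReal.ofReal (∏ i, f (x i)) := by
  have : SigmaFinite (μ.withDensity fun x => ENNReal.ofReal (f x)) :=
    SigmaFinite.withDensity_ofReal f
  refine Measure.pi_eq fun s hs => ?_
  rw [withDensity_apply _ (MeasurableSet.univ_pi hs), Measure.restrict_pi_pi,
    ← ofReal_integral_eq_lintegral_ofReal]
  · rw [integral_fintype_prod_eq_prod (fun _ => f),
      ENNReal.ofReal_prod_of_nonneg fun i _ => integral_nonneg h0]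
    refine Finset.prod_congr rfl fun i _ => ?_
    rw [withDensity_apply _ (hs i), ofReal_integral_eq_lintegral_ofReal hf.restrict
      (ae_of_all _ h0)]
  · exact Integrable.fintype_prod_dep fun i => hf.restrict
  · exact ae_of_all _ fun x => Finset.prod_nonneg fun i _ => h0 _

/-- The density of the standard complex Gaussian law `CN(0, 1)`. -/
noncomputable def complexGaussianPDF (z : ℂ) : ℝ := Real.pi⁻¹ * Real.exp (-Complex.normSq z)

lemma complexGaussianPDF_pos (z : ℂ) : 0 < complexGaussianPDF z := by
  unfold complexGaussianPDF
  positivity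

lemma measurable_complexGaussianPDF : Measurable complexGaussianPDF := by
  unfold complexGaussianPDF
  have := Complex.continuous_normSq.measurable
  fun_prop

lemma complexGaussian_one_eq_withDensity :
    complexGaussian 1 = volume.withDensity fun z => ENNReal.ofReal (complexGaussianPDF z) := by
  have hv : (1 / 2 : ℝ≥0) ≠ 0 := by simp
  have e : ∀ p : ℝ × ℝ, gaussianPDF 0 (1 / 2) p.1 * gaussianPDF 0 (1 / 2) p.2
      = ENNReal.ofReal (complexGaussianPDF (Complex.measurableEquivRealProd.symm p)) := by
    intro p
    rw [gaussianPDF, gaussianPDF, ← ENNReal.ofReal_mul (gaussianPDFReal_nonneg _ _ _)]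
    congr 1
    simp only [gaussianPDFReal, complexGaussianPDF, Complex.measurableEquivRealProd,
      Complex.normSq_apply]
    rw [mul_mul_mul_comm, ← Real.exp_add, ← mul_inv, Real.mul_self_sqrt (by positivity)]
    congr 2
    · push_cast
      ring
    · simp
      ring
  rw [complexGaussian_eq_map, gaussianReal_of_var_ne_zero _ hv,
    prod_withDensity (measurable_gaussianPDF _ _) (measurable_gaussianPDF _ _)]
  simp_rw [e]
  ext s hs
  have hm := Complex.measurableEquivRealProd.symm.measurable hs
  rw [MeasurableEquiv.map_apply, withDensity_apply _ hm, withDensity_apply _ hs]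
  exact Complex.volume_preserving_equiv_real_prod.symm.setLIntegral_comp_preimage_emb
    (Complex.measurableEquivRealProd.symm.measurableEmbedding)
    (fun z => ENNReal.ofReal (complexGaussianPDF z)) s

lemma integrable_complexGaussianPDF : Integrable complexGaussianPDF := by
  refine ⟨measurable_complexGaussianPDF.aestronglyMeasurable, ?_⟩
  rw [hasFiniteIntegral_iff_ofReal (ae_of_all _ fun z => (complexGaussianPDF_pos z).le)]
  have h := measure_univ (μ := complexGaussian 1)
  rw [complexGaussian_one_eq_withDensity, withDensity_apply _ .univ, Measure.restrict_univ] at h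
  simp [h]

lemma pi_complexGaussian_one_eq_withDensity :
    (Measure.pi fun _ : ι => complexGaussian 1)
      = volume.withDensity fun z => ENNReal.ofReal (∏ i, complexGaussianPDF (z i)) := by
  rw [complexGaussian_one_eq_withDensity]
  exact pi_withDensity_ofReal volume integrable_complexGaussianPDF
    fun z => (complexGaussianPDF_pos z).le

/-- As a real linear map, `B` has determinant |det B|², the norm of det B from ℂ to ℝ. -/
lemma map_mulVec_volume [DecidableEq ι] {B : Matrix ι ι ℂ} (hB : IsUnit B.det) :
    (volume : Measure (ι → ℂ)).map (B *ᵥ ·)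
      = ENNReal.ofReal (Complex.normSq B.det)⁻¹ • volume := by
  have hd : LinearMap.det ((Matrix.toLin' B).restrictScalars ℝ) = Complex.normSq B.det := by
    rw [LinearMap.det_restrictScalars, LinearMap.det_toLin', Algebra.norm_complex_apply]
  have hne : LinearMap.det ((Matrix.toLin' B).restrictScalars ℝ) ≠ 0 := by
    rw [hd]
    simpa using hB.ne_zero
  have h := Measure.map_linearMap_addHaar_eq_smul_addHaar (volume : Measure (ι → ℂ)) hne
  rw [hd, abs_of_nonneg (inv_nonneg.2 (Complex.normSq_nonneg _))] at h
  exact h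

lemma map_mulVec_withDensity [DecidableEq ι] {B : Matrix ι ι ℂ} (hB : IsUnit B.det)
    {f : (ι → ℂ) → ℝ} (hf : Measurable f) :
    (volume.withDensity fun z => ENNReal.ofReal (f z)).map (B *ᵥ ·)
      = volume.withDensity fun z =>
        ENNReal.ofReal ((Complex.normSq B.det)⁻¹ * f (B⁻¹ *ᵥ z)) := by
  have hm := measurable_mulVec B
  have hm' := measurable_mulVec B⁻¹
  ext s hs
  have h0 : 0 ≤ (Complex.normSq B.det)⁻¹ := inv_nonneg.2 (Complex.normSq_nonneg _)
  simp_rw [ENNReal.ofReal_mul h0]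
  rw [Measure.map_apply hm hs, withDensity_apply _ (hm hs), withDensity_apply _ hs,
    lintegral_const_mul _ (by fun_prop), ← smul_eq_mul, ← lintegral_smul_measure,
    ← Measure.restrict_smul, ← map_mulVec_volume hB, setLIntegral_map hs (by fun_prop) hm]
  refine setLIntegral_congr_fun (hm hs) fun z _ => ?_
  simp only [mulVec_mulVec, nonsing_inv_mul _ hB, one_mulVec]

/-- A nondegenerate complex normal law has a positive density, and its differential entropy is
`n log π + n + log det R`. -/
lemma IsComplexNormal.exists_density [DecidableEq ι] {μ : Measure (ι → ℂ)} [IsFiniteMeasure μ]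
    {R : Matrix ι ι ℝ} (hR : R.PosDef) (h : IsComplexNormal μ (R.map ((↑) : ℝ → ℂ))) :
    ∃ f : (ι → ℂ) → ℝ, Measurable f ∧ (∀ z, 0 < f z) ∧
      μ = volume.withDensity (fun z => ENNReal.ofReal (f z)) ∧
      Integrable (fun z => Real.log (f z)) μ ∧
      ∫ z, Real.log (f z) ∂μ
        = -(Fintype.card ι * (Real.log Real.pi + 1)) - Real.log R.det := by
  obtain ⟨B₀, hB₀, rfl⟩ := hR.exists_isUnit_det_mul_transpose
  set B := B₀.map ((↑) : ℝ → ℂ) with hBdef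
  have hdet : B.det = (B₀.det : ℂ) := (RingHom.map_det Complex.ofRealHom B₀).symm
  have hB : IsUnit B.det := by
    rw [hdet]
    simpa using hB₀
  have hns : Complex.normSq B.det = (B₀ * B₀ᵀ).det := by
    rw [hdet, Complex.normSq_ofReal, det_mul, det_transpose]
  have hpos : 0 < (B₀ * B₀ᵀ).det := hR.det_pos
  have hm := measurable_mulVec B
  have hm' := measurable_mulVec B⁻¹
  have hF : Measurable fun z : ι → ℂ => ∏ i, complexGaussianPDF (z i) :=
    Finset.measurable_prod _ fun i _ => measurable_complexGaussianPDF.comp (measurable_pi_apply i)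
  have hμ := h.eq_map_mulVec (map_ofReal_mul_transpose B₀)
  set f : (ι → ℂ) → ℝ :=
    fun z => (Complex.normSq B.det)⁻¹ * ∏ i, complexGaussianPDF ((B⁻¹ *ᵥ z) i) with hf
  have hfm : Measurable f := by
    have := hF.comp hm'
    exact this.const_mul _
  -- In the standard coordinates the log-density is a constant minus the sum of the |g i|², each of
  -- mean 1; integrability and entropy are read off from this.
  have hlog : ∀ g, Real.log (f (B *ᵥ g)) = -(Fintype.card ι * Real.log Real.pi)
      - Real.log (B₀ * B₀ᵀ).det - ∑ i, Complex.normSq (g i) := by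
    intro g
    simp only [hf, mulVec_mulVec, nonsing_inv_mul _ hB, one_mulVec]
    rw [Real.log_mul (inv_ne_zero (hns ▸ hpos.ne'))
      (Finset.prod_pos fun i _ => complexGaussianPDF_pos _).ne', Real.log_inv, hns,
      Real.log_prod fun i _ => (complexGaussianPDF_pos _).ne']
    have : ∀ z, Real.log (complexGaussianPDF z) = -Real.log Real.pi - Complex.normSq z := by
      intro z
      rw [complexGaussianPDF, Real.log_mul (by positivity) (by positivity), Real.log_inv,
        Real.log_exp]
      ring
    simp only [this, Finset.sum_sub_distrib, Finset.sum_const, Finset.card_univ, nsmul_eq_mul]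
    ring
  have hn := integral_normSq_complexGaussian 1
  have hi : ∀ i : ι, Integrable (fun g : ι → ℂ => Complex.normSq (g i))
      (Measure.pi fun _ => complexGaussian 1) := fun i =>
    integrable_comp_eval (μ := fun _ : ι => complexGaussian 1) hn.1
  have hs : Integrable (fun g : ι → ℂ => ∑ i, Complex.normSq (g i))
      (Measure.pi fun _ => complexGaussian 1) := integrable_finsetSum _ fun i _ => hi i
  have hlm : AEStronglyMeasurable (fun z => Real.log (f z))
      ((Measure.pi fun _ => complexGaussian 1).map (B *ᵥ ·)) :=
    (Real.measurable_log.comp hfm).aestronglyMeasurable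
  refine ⟨f, hfm, fun z => ?_, ?_, ?_, ?_⟩
  · exact mul_pos (inv_pos.2 (hns ▸ hpos)) (Finset.prod_pos fun i _ => complexGaussianPDF_pos _)
  · rw [hμ, pi_complexGaussian_one_eq_withDensity, map_mulVec_withDensity hB hF]
  · rw [hμ, integrable_map_measure hlm hm.aemeasurable]
    simp only [Function.comp_def, hlog]
    exact (integrable_const _).sub hs
  · rw [hμ, integral_map hm.aemeasurable hlm]
    simp only [hlog]
    rw [integral_sub (integrable_const _) hs, integral_finsetSum _ fun i _ => hi i]
    have : ∀ i : ι, ∫ g : ι → ℂ, Complex.normSq (g i) ∂(Measure.pi fun _ => complexGaussian 1)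
        = 1 := by
      intro i
      rw [integral_comp_eval (μ := fun _ : ι => complexGaussian 1) hn.1.aestronglyMeasurable, hn.2]
      rfl
    simp only [this, integral_const, probReal_univ, Finset.sum_const, Finset.card_univ,
      nsmul_eq_mul, smul_eq_mul]
    ring

end Density

/-! ### Mutual information of additive noise channels. -/

section AdditiveNoise

variable {E F : Type*} [MeasurableSpace E] [AddCommGroup E] [MeasurableAdd₂ E] [MeasurableSub₂ E]
  [MeasurableSpace F]

/-- Radon-Nikodym derivative of the joint law of the output `c x + z` and the input `x` of an
additive noise channel with respect to the product of the marginal laws. -/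
lemma map_additive_noise_eq_withDensity {lam : Measure E} [SFinite lam]
    [lam.IsAddLeftInvariant] {μ : Measure F} [IsProbabilityMeasure μ] {ν : Measure E}
    [IsProbabilityMeasure ν] {c : F → E} (hc : Measurable c) {f g : E → ℝ} (hf : Measurable f)
    (hg : Measurable g) (hg0 : ∀ r, 0 < g r)
    (hν : ν = lam.withDensity fun z => ENNReal.ofReal (f z))
    (hρ : (μ.prod ν).map (fun p => c p.1 + p.2) = lam.withDensity fun z => ENNReal.ofReal (g z)) :
    (μ.prod ν).map (fun p => (c p.1 + p.2, p.1))
      = (((μ.prod ν).map fun p => c p.1 + p.2).prod μ).withDensity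
        fun q => ENNReal.ofReal (f (q.1 - c q.2) / g q.1) := by
  have hD : Measurable fun q : E × F => ENNReal.ofReal (f (q.1 - c q.2) / g q.1) := by fun_prop
  ext s hs
  have : IsProbabilityMeasure (lam.withDensity fun z => ENNReal.ofReal (g z)) := by
    rw [← hρ]
    exact Measure.isProbabilityMeasure_map (by fun_prop)
  have hi : Measurable (s.indicator (1 : E × F → ℝ≥0∞)) := measurable_one.indicator hs
  rw [withDensity_apply _ hs, ← lintegral_indicator hs, hρ, lintegral_prod_symm _
    (hD.indicator hs).aemeasurable, ← lintegral_indicator_one hs,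
    lintegral_map hi (by fun_prop), lintegral_prod _ (by fun_prop)]
  refine lintegral_congr fun x => ?_
  have hDx : Measurable fun r : E => s.indicator
      (fun q => ENNReal.ofReal (f (q.1 - c q.2) / g q.1)) (r, x) :=
    (hD.indicator hs).comp measurable_prodMk_right
  rw [lintegral_withDensity_eq_lintegral_mul _ (by fun_prop) hDx, hν,
    lintegral_withDensity_eq_lintegral_mul _ (by fun_prop) (by fun_prop)]
  -- For fixed x, translation invariance substitutes r = c x + z. The quotient f(z) / g(r) then
  -- cancels the output density g(r).
  conv_rhs => rw [← lintegral_add_left_eq_self _ (c x)]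
  refine lintegral_congr fun z => ?_
  simp only [Pi.mul_apply, Set.indicator, Pi.one_apply]
  split_ifs
  · rw [mul_one, ← ENNReal.ofReal_mul (hg0 _).le, add_sub_cancel_left,
      mul_div_cancel₀ _ (hg0 _).ne']
  · simp

/-- The mutual information between the output and the input of an additive noise channel is the
difference of the differential entropies of the output and of the noise. -/
lemma klDiv_map_additive_noise {lam : Measure E} [SFinite lam]
    [lam.IsAddLeftInvariant] {μ : Measure F} [IsProbabilityMeasure μ] {ν : Measure E}
    [IsProbabilityMeasure ν] {c : F → E} (hc : Measurable c) {f g : E → ℝ} (hf : Measurable f)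
    (hf0 : ∀ z, 0 < f z) (hg : Measurable g) (hg0 : ∀ r, 0 < g r)
    (hν : ν = lam.withDensity fun z => ENNReal.ofReal (f z))
    (hρ : (μ.prod ν).map (fun p => c p.1 + p.2) = lam.withDensity fun z => ENNReal.ofReal (g z))
    (hfi : Integrable (fun z => Real.log (f z)) ν)
    (hgi : Integrable (fun r => Real.log (g r)) ((μ.prod ν).map fun p => c p.1 + p.2)) :
    InformationTheory.klDiv ((μ.prod ν).map fun p => (c p.1 + p.2, p.1))
        (((μ.prod ν).map fun p => c p.1 + p.2).prod μ) ≠ ⊤ ∧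
      (InformationTheory.klDiv ((μ.prod ν).map fun p => (c p.1 + p.2, p.1))
        (((μ.prod ν).map fun p => c p.1 + p.2).prod μ)).toReal
        = ∫ z, Real.log (f z) ∂ν
          - ∫ r, Real.log (g r) ∂((μ.prod ν).map fun p => c p.1 + p.2) := by
  have hD : Measurable fun q : E × F => ENNReal.ofReal (f (q.1 - c q.2) / g q.1) := by fun_prop
  have hm : Measurable fun p : F × E => c p.1 + p.2 := by fun_prop
  have hm2 : Measurable fun p : F × E => (c p.1 + p.2, p.1) := by fun_prop
  have hJ := map_additive_noise_eq_withDensity hc hf hg hg0 hν hρ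
  have : IsProbabilityMeasure ((μ.prod ν).map fun p => c p.1 + p.2) :=
    Measure.isProbabilityMeasure_map hm.aemeasurable
  have : IsProbabilityMeasure ((μ.prod ν).map fun p => (c p.1 + p.2, p.1)) :=
    Measure.isProbabilityMeasure_map hm2.aemeasurable
  have hac : ((μ.prod ν).map fun p => (c p.1 + p.2, p.1))
      ≪ (((μ.prod ν).map fun p => c p.1 + p.2).prod μ) :=
    hJ ▸ withDensity_absolutelyContinuous _ _
  have hrn := Measure.rnDeriv_withDensity (((μ.prod ν).map fun p => c p.1 + p.2).prod μ) hD
  rw [← hJ] at hrn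
  have hllr : llr ((μ.prod ν).map fun p => (c p.1 + p.2, p.1))
      (((μ.prod ν).map fun p => c p.1 + p.2).prod μ)
      =ᵐ[(μ.prod ν).map fun p => (c p.1 + p.2, p.1)]
      fun q => Real.log (f (q.1 - c q.2)) - Real.log (g q.1) := by
    filter_upwards [hac.ae_le hrn] with q hq
    rw [llr, hq, ENNReal.toReal_ofReal (div_nonneg (hf0 _).le (hg0 _).le),
      Real.log_div (hf0 _).ne' (hg0 _).ne']
  have hlm : AEStronglyMeasurable (fun q : E × F => Real.log (f (q.1 - c q.2)) - Real.log (g q.1))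
      ((μ.prod ν).map fun p => (c p.1 + p.2, p.1)) := by
    refine Measurable.aestronglyMeasurable ?_
    fun_prop
  have hfi' : Integrable (fun p : F × E => Real.log (f p.2)) (μ.prod ν) := hfi.comp_snd μ
  have hgi' : Integrable (fun p : F × E => Real.log (g (c p.1 + p.2))) (μ.prod ν) :=
    hgi.comp_measurable hm
  have hint : Integrable (llr ((μ.prod ν).map fun p => (c p.1 + p.2, p.1))
      (((μ.prod ν).map fun p => c p.1 + p.2).prod μ))
      ((μ.prod ν).map fun p => (c p.1 + p.2, p.1)) := by
    rw [integrable_congr hllr, integrable_map_measure hlm hm2.aemeasurable]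
    simp only [Function.comp_def, add_sub_cancel_left]
    exact hfi'.sub hgi'
  refine ⟨InformationTheory.klDiv_ne_top hac hint, ?_⟩
  -- Both measures have mass 1, so the divergence is just the integral of the log-likelihood ratio.
  rw [InformationTheory.toReal_klDiv_of_measure_eq hac (by simp), integral_congr_ae hllr,
    integral_map hm2.aemeasurable hlm]
  simp only [add_sub_cancel_left]
  rw [integral_sub hfi' hgi', integral_fun_snd (fun z => Real.log (f z)),
    integral_map hm.aemeasurable hgi.aestronglyMeasurable]
  simp

/-- Mutual information of a linear channel with complex normal noise and output. -/
lemma IsComplexNormal.klDiv_map {ι : Type*} [Fintype ι] [DecidableEq ι] {μ : Measure F}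
    [IsProbabilityMeasure μ] {ν : Measure (ι → ℂ)} [IsProbabilityMeasure ν] {c : F → ι → ℂ}
    (hc : Measurable c) {R R' : Matrix ι ι ℝ} (hR : R.PosDef) (hR' : R'.PosDef)
    (hν : IsComplexNormal ν (R.map ((↑) : ℝ → ℂ)))
    (hρ : IsComplexNormal ((μ.prod ν).map fun p => c p.1 + p.2) (R'.map ((↑) : ℝ → ℂ))) :
    InformationTheory.klDiv ((μ.prod ν).map fun p => (c p.1 + p.2, p.1))
        (((μ.prod ν).map fun p => c p.1 + p.2).prod μ) ≠ ⊤ ∧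
      (InformationTheory.klDiv ((μ.prod ν).map fun p => (c p.1 + p.2, p.1))
        (((μ.prod ν).map fun p => c p.1 + p.2).prod μ)).toReal
        = Real.log R'.det - Real.log R.det := by
  obtain ⟨f, hf, hf0, hfν, hfi, hfe⟩ := hν.exists_density hR
  have : IsProbabilityMeasure ((μ.prod ν).map fun p => c p.1 + p.2) :=
    Measure.isProbabilityMeasure_map (by fun_prop)
  obtain ⟨g, hg, hg0, hgρ, hgi, hge⟩ := hρ.exists_density hR'
  obtain ⟨h1, h2⟩ := klDiv_map_additive_noise hc hf hf0 hg hg0 hfν hgρ hfi hgi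
  refine ⟨h1, ?_⟩
  rw [h2, hfe, hge]
  ring

end AdditiveNoise

/-! ### Conditioning a product measure on its first coordinate. -/

section Conditioning

/-- Conditionally on the value of the first coordinate, the second coordinate of a product measure
keeps its law. -/
lemma cond_prod_preimage_singleton {T Ω : Type*} [MeasurableSpace T] [MeasurableSingletonClass T]
    [MeasurableSpace Ω] (κ : Measure T) [IsFiniteMeasure κ] (ν : Measure Ω) [IsProbabilityMeasure ν]
    {a : T} (ha : κ.prod ν (Prod.fst ⁻¹' {a}) ≠ 0) :
    cond (κ.prod ν) (Prod.fst ⁻¹' {a}) = ν.map (Prod.mk a) := by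
  have e : (Prod.fst ⁻¹' {a} : Set (T × Ω)) = {a} ×ˢ Set.univ := by
    ext p
    simp
  have h : κ.prod ν (Prod.fst ⁻¹' {a}) = κ {a} := by
    rw [e, Measure.prod_prod, measure_univ, mul_one]
  rw [h] at ha
  rw [ProbabilityTheory.cond, h, e, ← Measure.prod_restrict, Measure.restrict_univ,
    Measure.restrict_singleton, Measure.prod_smul_left, smul_smul,
    ENNReal.inv_mul_cancel ha (measure_ne_top _ _), one_smul, Measure.dirac_prod]

end Conditioning

/-! ### Real matrices acting on complex vectors. -/

section RealMatrices

open Matrix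

variable {ι κ l : Type*} [Fintype ι] [Fintype κ]

lemma isComplexNormal_map_ofReal_mulVec [DecidableEq ι] (v : ℝ≥0) (C : Matrix κ ι ℝ) :
    IsComplexNormal ((Measure.pi fun _ : ι => complexGaussian v).map
      (C.map ((↑) : ℝ → ℂ) *ᵥ ·)) (((v : ℝ) • (C * Cᵀ)).map ((↑) : ℝ → ℂ)) := by
  have h := (isComplexNormal_pi_complexGaussian (ι := ι) v).map_mulVec (C.map ((↑) : ℝ → ℂ))
  convert! h using 1
  rw [Matrix.mul_smul, Matrix.mul_one, Matrix.smul_mul, ← map_ofReal_mul_transpose]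
  ext i j
  simp

lemma IsComplexNormal.map_add_ofReal {Ω Ω' : Type*} [MeasurableSpace Ω] [MeasurableSpace Ω']
    {μ : Measure Ω} {ν : Measure Ω'} [SFinite μ] [SFinite ν] {f : Ω → ι → ℂ} {g : Ω' → ι → ℂ}
    {R R' : Matrix ι ι ℝ} (hf : Measurable f) (hg : Measurable g)
    (h : IsComplexNormal (μ.map f) (R.map ((↑) : ℝ → ℂ)))
    (h' : IsComplexNormal (ν.map g) (R'.map ((↑) : ℝ → ℂ))) :
    IsComplexNormal ((μ.prod ν).map fun p => f p.1 + g p.2) ((R + R').map ((↑) : ℝ → ℂ)) := by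
  convert! h.map_add hf hg h' using 1
  ext i j
  simp

omit [Fintype ι] in
lemma map_ofReal_mul_mulVec [Fintype l] (A : Matrix ι κ ℝ) (B : Matrix κ l ℝ) (x : l → ℂ) :
    (A * B).map ((↑) : ℝ → ℂ) *ᵥ x
      = A.map ((↑) : ℝ → ℂ) *ᵥ (B.map ((↑) : ℝ → ℂ) *ᵥ x) := by
  rw [mulVec_mulVec]
  congr 1
  ext i j
  simp [mul_apply]

end RealMatrices

/-! ### The network as a linear map of its independent inputs. -/

namespace CRAN

open Matrix

variable (N : CRAN) {M m lF η : ℕ}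

lemma scaling_pos : 0 < N.scaling :=
  Real.sqrt_pos.2 <| div_pos N.Pc_pos <|
    add_pos_of_nonneg_of_pos (mul_nonneg N.PB.2 (by positivity)) one_pos

lemma transpose_Hc : (N.Hc m η)ᵀ = N.Hc m η := by
  ext i j
  simp [Hc, Matrix.one_apply, eq_comm]

/-- The map from the URLLC signal to the signal available at the BBU. -/
noncomputable def urllcGain (m lF η : ℕ) (a : Activity M) : Matrix (Res M m lF) (Res M m lF) ℝ :=
  ((N.β • activityMatrix a) ⊗ₖ N.Hc m η) ⊗ₖ (1 : Matrix (Fin lF) (Fin lF) ℝ)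

/-- The map from the radio signal to the signal available at the BBU. -/
noncomputable def fronthaulGain (M m lF η : ℕ) : Matrix (Res M m lF) (Res M m lF) ℝ :=
  ((1 : Matrix (Fin M) (Fin M) ℝ) ⊗ₖ N.Hc m η) ⊗ₖ (1 : Matrix (Fin lF) (Fin lF) ℝ)

/-- The map from the eMBB signal to the signal available at the BBU. -/
noncomputable def embbGain (M m lF η : ℕ) [NeZero M] : Matrix (Res M m lF) (Res M m lF) ℝ :=
  N.Heq M m η ⊗ₖ (1 : Matrix (Fin lF) (Fin lF) ℝ)

/-- The map from the cable noise to the signal available at the BBU. -/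
noncomputable def cableNoiseGain (M m lF η : ℕ) : Matrix (Res M m lF) (CableRes M m lF η) ℝ :=
  Matrix.of fun r c =>
    if r.1.1 = c.1.1 ∧ r.1.2 = c.1.2.1 ∧ r.2 = c.2 then N.scaling⁻¹ * (η : ℝ)⁻¹ else 0

lemma kronecker_one_kronecker_one_mulVec (K : Matrix (Fin M) (Fin M) ℝ) (x : Signal M m lF)
    (k : Fin M) (j : Fin m) (i : Fin lF) :
    (((K ⊗ₖ (1 : Matrix (Fin m) (Fin m) ℝ)) ⊗ₖ (1 : Matrix (Fin lF) (Fin lF) ℝ)).map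
      ((↑) : ℝ → ℂ) *ᵥ x) ((k, j), i) = ∑ k', (K k k' : ℂ) * x ((k', j), i) := by
  simp [mulVec, dotProduct, Fintype.sum_prod_type, Matrix.one_apply, apply_ite Complex.ofReal]

lemma fronthaulGain_mulVec (y : Signal M m lF) (k : Fin M) (j : Fin m) (i : Fin lF) :
    ((N.fronthaulGain M m lF η).map ((↑) : ℝ → ℂ) *ᵥ y) ((k, j), i)
      = ∑ j', (N.Hc m η j j' : ℂ) * y ((k, j'), i) := by
  simp [fronthaulGain, mulVec, dotProduct, Fintype.sum_prod_type, Matrix.one_apply,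
    apply_ite Complex.ofReal]

lemma cableNoiseGain_mulVec (w : CableNoise M m lF η) (k : Fin M) (j : Fin m) (i : Fin lF) :
    ((N.cableNoiseGain M m lF η).map ((↑) : ℝ → ℂ) *ᵥ w) ((k, j), i)
      = (N.scaling : ℂ)⁻¹ * (η : ℂ)⁻¹ * ∑ e, w ((k, (j, e)), i) := by
  simp only [cableNoiseGain, mulVec, dotProduct, Fintype.sum_prod_type, ite_and, Finset.mul_sum,
    map_apply, of_apply]
  rw [Finset.sum_eq_single k (by simp +contextual [eq_comm]) (by simp),
    Finset.sum_eq_single j (by simp +contextual [eq_comm]) (by simp)]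
  simp [apply_ite Complex.ofReal]

lemma radio_eq [NeZero M] (a : Activity M) (x u z : Signal M m lF) :
    N.radio a x u z =
      ((N.H M ⊗ₖ (1 : Matrix (Fin m) (Fin m) ℝ)) ⊗ₖ (1 : Matrix (Fin lF) (Fin lF) ℝ)).map
          ((↑) : ℝ → ℂ) *ᵥ x
      + ((((N.β • activityMatrix a) ⊗ₖ (1 : Matrix (Fin m) (Fin m) ℝ))
          ⊗ₖ (1 : Matrix (Fin lF) (Fin lF) ℝ)).map ((↑) : ℝ → ℂ) *ᵥ u + z) := by
  ext ⟨⟨k, j⟩, i⟩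
  rw [Pi.add_apply, Pi.add_apply, kronecker_one_kronecker_one_mulVec,
    kronecker_one_kronecker_one_mulVec]
  have h1 : ∑ k', ((N.β • activityMatrix a) k k' : ℂ) * u ((k', j), i)
      = (N.β : ℂ) * (if a k then 1 else 0) * u ((k, j), i) := by
    rw [Finset.sum_eq_single k]
    · simp [activityMatrix, apply_ite Complex.ofReal]
    · intro b _ hb
      simp [activityMatrix, hb.symm]
    · simp
  have h2 : ∑ k', (N.H M k k' : ℂ) * x ((k', j), i)
      = x ((k, j), i) + (N.α : ℂ) * x ((k - 1, j), i) + (N.α : ℂ) * x ((k + 1, j), i) := by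
    -- The three summands of the circulant are evaluated separately, without assuming disjoint
    -- supports; so entries that coincide for M ≤ 2 add up exactly as in `radio`.
    have e1 : ∀ k', k - k' = 0 ↔ k' = k := fun k' => by rw [sub_eq_zero, eq_comm]
    have e2 : ∀ k', k - k' = 1 ↔ k' = k - 1 := fun k' => by
      constructor
      · intro h
        rw [← h, sub_sub_cancel]
      · rintro rfl
        rw [sub_sub_cancel]
    have e3 : ∀ k', k - k' = -1 ↔ k' = k + 1 := fun k' => by
      constructor
      · intro h
        rw [← sub_neg_eq_add, ← h, sub_sub_cancel]
      · rintro rfl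
        rw [sub_add_cancel_left]
    simp only [H, circulant_apply, Pi.add_apply, Pi.single_apply, e1, e2, e3, Complex.ofReal_add,
      add_mul, Finset.sum_add_distrib]
    simp [apply_ite Complex.ofReal]
  rw [h1, h2]
  simp only [radio]
  ring

lemma bbu_eq [NeZero η] (y : Signal M m lF) (w : CableNoise M m lF η) :
    N.bbu y w = (N.fronthaulGain M m lF η).map ((↑) : ℝ → ℂ) *ᵥ y
      + (N.cableNoiseGain M m lF η).map ((↑) : ℝ → ℂ) *ᵥ w := by
  have hs : (N.scaling : ℂ) ≠ 0 := by exact_mod_cast N.scaling_pos.ne'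
  have hη : (η : ℂ) ≠ 0 := by exact_mod_cast NeZero.ne η
  ext ⟨⟨k, j⟩, i⟩
  rw [Pi.add_apply, fronthaulGain_mulVec, cableNoiseGain_mulVec]
  -- The noiseless output of pair (j, e) does not depend on e: crosstalk sums η equal copies of each
  -- block, turning γ into γη, while 1 − γ meets a single copy. Averaging over e then changes
  -- nothing.
  have hin : ∀ e : Fin η, ∑ p' : Fin m × Fin η,
      (N.scaling : ℂ) * cableInput (η := η) y k i p' * (N.cableChannel p' (j, e) : ℂ)
      = (N.scaling : ℂ) * ∑ j', (N.Hc m η j j' : ℂ) * y ((k, j'), i) := by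
    intro e
    simp only [Fintype.sum_prod_type, cableInput, cableChannel, Hc, of_apply, Matrix.add_apply,
      Matrix.smul_apply, Matrix.one_apply, Prod.mk.injEq, smul_eq_mul, mul_one, ite_and]
    rw [Finset.mul_sum]
    refine Finset.sum_congr rfl fun j' _ => ?_
    by_cases h : j' = j
    · subst h
      simp only [if_true, Complex.ofReal_add, Complex.ofReal_mul, mul_add, Finset.sum_add_distrib,
        apply_ite Complex.ofReal, Complex.ofReal_zero, mul_ite, mul_one,
        mul_zero, Finset.sum_ite_eq', Finset.mem_univ, Finset.sum_const, Finset.card_univ,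
        Fintype.card_fin, nsmul_eq_mul, Complex.ofReal_natCast]
      ring
    · simp [h, Ne.symm h]
      ring
  simp only [bbu, cableOutput, combiner, of_apply]
  rw [Fintype.sum_prod_type, Finset.sum_eq_single j]
  · simp only [hin, if_true]
    rw [← Finset.sum_mul, Finset.sum_add_distrib]
    simp
    field_simp
  · intro b _ hb
    simp [hb]
  · simp

/-- The mixed product rule merges each radio map with the fronthaul. Radio noise also crosses the
fronthaul channel; cable noise is only combined and rescaled. -/
lemma received_eq [NeZero M] [NeZero η] (s : Sample M m lF η) :
    N.received s = (N.embbGain M m lF η).map ((↑) : ℝ → ℂ) *ᵥ s.2.1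
      + ((N.urllcGain m lF η s.1).map ((↑) : ℝ → ℂ) *ᵥ s.2.2.1
        + ((N.fronthaulGain M m lF η).map ((↑) : ℝ → ℂ) *ᵥ s.2.2.2.1
          + (N.cableNoiseGain M m lF η).map ((↑) : ℝ → ℂ) *ᵥ s.2.2.2.2)) := by
  have h1 : N.embbGain M m lF η = N.fronthaulGain M m lF η *
      ((N.H M ⊗ₖ (1 : Matrix (Fin m) (Fin m) ℝ)) ⊗ₖ (1 : Matrix (Fin lF) (Fin lF) ℝ)) := by
    rw [fronthaulGain, ← mul_kronecker_mul, ← mul_kronecker_mul, Matrix.one_mul, Matrix.mul_one,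
      Matrix.mul_one]
    rfl
  have h2 : N.urllcGain m lF η s.1 = N.fronthaulGain M m lF η *
      (((N.β • activityMatrix s.1) ⊗ₖ (1 : Matrix (Fin m) (Fin m) ℝ))
        ⊗ₖ (1 : Matrix (Fin lF) (Fin lF) ℝ)) := by
    rw [fronthaulGain, ← mul_kronecker_mul, ← mul_kronecker_mul, Matrix.one_mul, Matrix.mul_one,
      Matrix.mul_one]
    rfl
  rw [received, bbu_eq, radio_eq, h1, h2, map_ofReal_mul_mulVec, map_ofReal_mul_mulVec, mulVec_add,
    mulVec_add]
  abel

lemma interference_eq [NeZero M] [NeZero η] (s : Sample M m lF η) :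
    N.interference s = (N.urllcGain m lF η s.1).map ((↑) : ℝ → ℂ) *ᵥ s.2.2.1
        + ((N.fronthaulGain M m lF η).map ((↑) : ℝ → ℂ) *ᵥ s.2.2.2.1
          + (N.cableNoiseGain M m lF η).map ((↑) : ℝ → ℂ) *ᵥ s.2.2.2.2) := by
  have h := N.received_eq (s.1, 0, s.2.2.1, s.2.2.2.1, s.2.2.2.2)
  rw [mulVec_zero, zero_add] at h
  exact h

end CRAN

/-! ### Covariances at the BBU. -/

namespace CRAN

open Matrix

variable (N : CRAN) {M m lF η : ℕ}

section Covariance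

lemma posSemidef_Hc_mul_Hc : (N.Hc m η * N.Hc m η).PosSemidef := by
  have h := posSemidef_self_mul_conjTranspose (N.Hc m η)
  rwa [conjTranspose_eq_transpose_of_trivial, transpose_Hc] at h

lemma posSemidef_activityMatrix (a : Activity M) : (activityMatrix a).PosSemidef := by
  rw [activityMatrix, posSemidef_diagonal_iff]
  intro k
  split_ifs <;> simp

lemma activityMatrix_mul_transpose (a : Activity M) :
    activityMatrix a * (activityMatrix a)ᵀ = activityMatrix a := by
  rw [activityMatrix, diagonal_transpose, diagonal_mul_diagonal]
  congr 1
  ext k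
  split_ifs <;> simp

/-- The cable noise term is a positive multiple of the identity; the others are only semidefinite,
since `Hc` and the activity matrix may be singular. -/
lemma posDef_RA [NeZero η] (a : Activity M) : (N.RA m η a).PosDef := by
  have hη : (0 : ℝ) < η := by exact_mod_cast NeZero.pos η
  have hs := N.scaling_pos
  have h1 : ((1 / (N.scaling ^ 2 * η)) • (1 : Matrix (Fin M × Fin m) (Fin M × Fin m) ℝ)).PosDef :=
    PosDef.one.smul (by positivity)
  have h2 : ((1 : Matrix (Fin M) (Fin M) ℝ) ⊗ₖ (N.Hc m η * N.Hc m η)).PosSemidef :=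
    PosSemidef.one.kronecker N.posSemidef_Hc_mul_Hc
  have h3 : ((N.β ^ 2 * N.PU) • (activityMatrix a ⊗ₖ (N.Hc m η * N.Hc m η))).PosSemidef :=
    ((posSemidef_activityMatrix a).kronecker N.posSemidef_Hc_mul_Hc).smul (by positivity)
  exact (h1.posSemidef_add h2).add_posSemidef h3

/-- The covariance, per frequency channel of a block, of the signal available at the BBU. -/
noncomputable def receivedCov [NeZero M] (m η : ℕ) (a : Activity M) :
    Matrix (Fin M × Fin m) (Fin M × Fin m) ℝ :=
  N.RA m η a + (N.PB : ℝ) • (N.Heq M m η * (N.Heq M m η)ᵀ)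

lemma posDef_receivedCov [NeZero M] [NeZero η] (a : Activity M) :
    (N.receivedCov m η a).PosDef := by
  have h : (N.Heq M m η * (N.Heq M m η)ᵀ).PosSemidef := by
    have h := posSemidef_self_mul_conjTranspose (N.Heq M m η)
    rwa [conjTranspose_eq_transpose_of_trivial] at h
  exact (N.posDef_RA a).add_posSemidef (h.smul N.PB.2)

/-- Multiplying `gainMatrix` on the left by `RA` gives `receivedCov`. -/
lemma det_gainMatrix [NeZero M] [NeZero η] (a : Activity M) :
    (N.gainMatrix m η a).det = (N.receivedCov m η a).det / (N.RA m η a).det := by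
  have h := (N.posDef_RA (m := m) (η := η) a).det_pos
  rw [eq_div_iff h.ne', mul_comm, ← det_mul, gainMatrix, receivedCov, Matrix.mul_add,
    Matrix.mul_one, Matrix.mul_smul, Matrix.mul_assoc, ← Matrix.mul_assoc,
    mul_nonsing_inv _ h.ne'.isUnit, Matrix.one_mul]

lemma det_gainMatrix_pos [NeZero M] [NeZero η] (a : Activity M) :
    0 < (N.gainMatrix m η a).det := by
  rw [det_gainMatrix]
  exact div_pos (N.posDef_receivedCov a).det_pos (N.posDef_RA a).det_pos

/-- Distinct rows have disjoint supports, and each row has η entries equal to 1/(λη), so its squared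
norm is η/(λη)² = 1/(λ²η). -/
lemma cableNoiseGain_mul_transpose [NeZero η] :
    N.cableNoiseGain M m lF η * (N.cableNoiseGain M m lF η)ᵀ
      = ((1 / (N.scaling ^ 2 * η)) • 1) ⊗ₖ (1 : Matrix (Fin lF) (Fin lF) ℝ) := by
  have hη : (η : ℝ) ≠ 0 := by exact_mod_cast NeZero.ne η
  have hs := N.scaling_pos.ne'
  ext ⟨⟨k, j⟩, i⟩ ⟨⟨k', j'⟩, i'⟩
  simp only [mul_apply, transpose_apply, cableNoiseGain, of_apply, Fintype.sum_prod_type, ite_and]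
  rw [Finset.sum_eq_single k (by simp +contextual [eq_comm]) (by simp),
    Finset.sum_eq_single j (by simp +contextual [eq_comm]) (by simp)]
  by_cases hk : k' = k
  · by_cases hj : j' = j
    · by_cases hi : i' = i
      · subst hk hj hi
        simp
        field_simp
      · simp [hk, hj, Ne.symm hi]
    · simp [hj, Ne.symm hj, Matrix.one_apply]
  · simp [hk, Ne.symm hk, Matrix.one_apply]

lemma urllcGain_mul_transpose (a : Activity M) :
    N.urllcGain m lF η a * (N.urllcGain m lF η a)ᵀ
      = (N.β ^ 2 • (activityMatrix a ⊗ₖ (N.Hc m η * N.Hc m η)))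
        ⊗ₖ (1 : Matrix (Fin lF) (Fin lF) ℝ) := by
  rw [urllcGain, ← kroneckerMap_transpose, ← kroneckerMap_transpose, ← mul_kronecker_mul,
    ← mul_kronecker_mul, transpose_Hc, transpose_one, Matrix.mul_one, transpose_smul,
    Matrix.smul_mul, Matrix.mul_smul, activityMatrix_mul_transpose, smul_smul, smul_kronecker,
    ← pow_two]

lemma fronthaulGain_mul_transpose :
    N.fronthaulGain M m lF η * (N.fronthaulGain M m lF η)ᵀ
      = ((1 : Matrix (Fin M) (Fin M) ℝ) ⊗ₖ (N.Hc m η * N.Hc m η))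
        ⊗ₖ (1 : Matrix (Fin lF) (Fin lF) ℝ) := by
  rw [fronthaulGain, ← kroneckerMap_transpose, ← kroneckerMap_transpose, ← mul_kronecker_mul,
    ← mul_kronecker_mul, transpose_Hc, transpose_one, transpose_one, Matrix.mul_one, Matrix.mul_one]

lemma embbGain_mul_transpose [NeZero M] :
    N.embbGain M m lF η * (N.embbGain M m lF η)ᵀ
      = (N.Heq M m η * (N.Heq M m η)ᵀ) ⊗ₖ (1 : Matrix (Fin lF) (Fin lF) ℝ) := by
  rw [embbGain, ← kroneckerMap_transpose, ← mul_kronecker_mul, transpose_one, Matrix.mul_one]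

end Covariance

/-! ### Conditional laws given the activity pattern. -/

section Laws

/-- The law of the eMBB signal. -/
noncomputable def embbLaw (M m lF : ℕ) : Measure (Signal M m lF) :=
  Measure.pi fun _ => complexGaussian N.PB

/-- The joint law of the URLLC signal, the radio noise and the cable noise. -/
noncomputable def disturbanceLaw (M m lF η : ℕ) :
    Measure (Signal M m lF × Signal M m lF × CableNoise M m lF η) :=
  (Measure.pi fun _ => complexGaussian N.PU).prod <|
    (Measure.pi fun _ => complexGaussian 1).prod (Measure.pi fun _ => complexGaussian 1)

instance : IsProbabilityMeasure (N.embbLaw M m lF) := by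
  unfold embbLaw
  infer_instance

instance : IsProbabilityMeasure (N.disturbanceLaw M m lF η) := by
  unfold disturbanceLaw
  infer_instance

instance : IsProbabilityMeasure (N.activityLaw M) := by
  unfold activityLaw
  infer_instance

lemma law_eq :
    N.law M m lF η = (N.activityLaw M).prod ((N.embbLaw M m lF).prod (N.disturbanceLaw M m lF η)) :=
  rfl

/-- Noise plus URLLC interference at the BBU for a given activity pattern. -/
noncomputable def noiseMap (a : Activity M)
    (p : Signal M m lF × Signal M m lF × CableNoise M m lF η) : Signal M m lF :=
  (N.urllcGain m lF η a).map ((↑) : ℝ → ℂ) *ᵥ p.1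
    + ((N.fronthaulGain M m lF η).map ((↑) : ℝ → ℂ) *ᵥ p.2.1
      + (N.cableNoiseGain M m lF η).map ((↑) : ℝ → ℂ) *ᵥ p.2.2)

lemma measurable_noiseMap (a : Activity M) :
    Measurable (N.noiseMap (m := m) (lF := lF) (η := η) a) :=
  ((measurable_mulVec _).comp measurable_fst).add
    (((measurable_mulVec _).comp (measurable_fst.comp measurable_snd)).add
      ((measurable_mulVec _).comp (measurable_snd.comp measurable_snd)))

lemma isComplexNormal_noise [NeZero η] (a : Activity M) :
    IsComplexNormal ((N.disturbanceLaw M m lF η).map (N.noiseMap a))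
      ((N.RA m η a ⊗ₖ (1 : Matrix (Fin lF) (Fin lF) ℝ)).map ((↑) : ℝ → ℂ)) := by
  have hu := isComplexNormal_map_ofReal_mulVec N.PU (N.urllcGain m lF η a)
  have hz := isComplexNormal_map_ofReal_mulVec 1 (N.fronthaulGain M m lF η)
  have hw := isComplexNormal_map_ofReal_mulVec 1 (N.cableNoiseGain M m lF η)
  have h := hu.map_add_ofReal (measurable_mulVec _) (by
    exact ((measurable_mulVec _).comp measurable_fst).add
      ((measurable_mulVec _).comp measurable_snd))
    (hz.map_add_ofReal (measurable_mulVec _) (measurable_mulVec _) hw)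
  convert! h using 2
  rw [urllcGain_mul_transpose, fronthaulGain_mul_transpose, cableNoiseGain_mul_transpose,
    NNReal.coe_one, one_smul, one_smul, ← add_kronecker, ← smul_kronecker, ← add_kronecker,
    smul_smul, RA, Rz, add_comm, mul_comm (N.β ^ 2)]

lemma isComplexNormal_received [NeZero M] [NeZero η] (a : Activity M) :
    IsComplexNormal (((N.embbLaw M m lF).prod
        ((N.disturbanceLaw M m lF η).map (N.noiseMap a))).map
        fun p => (N.embbGain M m lF η).map ((↑) : ℝ → ℂ) *ᵥ p.1 + p.2)
      ((N.receivedCov m η a ⊗ₖ (1 : Matrix (Fin lF) (Fin lF) ℝ)).map ((↑) : ℝ → ℂ)) := by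
  have hx := isComplexNormal_map_ofReal_mulVec N.PB (N.embbGain M m lF η)
  have hn := N.isComplexNormal_noise (m := m) (lF := lF) (η := η) a
  have h := hx.map_add_ofReal (measurable_mulVec _) measurable_id
    (ν := (N.disturbanceLaw M m lF η).map (N.noiseMap a)) (by rwa [Measure.map_id])
  convert! h using 2
  rw [embbGain_mul_transpose, ← smul_kronecker, ← add_kronecker, receivedCov, add_comm]

lemma cond_law {a : Activity M} (ha : N.law M m lF η (activity ⁻¹' {a}) ≠ 0) :
    cond (N.law M m lF η) (activity ⁻¹' {a})
      = ((N.embbLaw M m lF).prod (N.disturbanceLaw M m lF η)).map (Prod.mk a) :=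
  cond_prod_preimage_singleton _ _ ha

lemma law_activity_preimage (a : Activity M) :
    N.law M m lF η (activity ⁻¹' {a}) = N.activityLaw M {a} := by
  have e : (activity ⁻¹' {a} : Set (Sample M m lF η)) = {a} ×ˢ Set.univ := by
    ext p
    simp [activity]
  rw [e, law_eq, Measure.prod_prod, measure_univ, mul_one]

lemma measurable_embbGain_noiseMap [NeZero M] (a : Activity M) :
    Measurable fun p : Signal M m lF × Signal M m lF × Signal M m lF × CableNoise M m lF η =>
      (N.embbGain M m lF η).map ((↑) : ℝ → ℂ) *ᵥ p.1 + N.noiseMap a p.2 :=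
  ((measurable_mulVec _).comp measurable_fst).add ((N.measurable_noiseMap a).comp measurable_snd)

/-- The activity has countably many values, so measurability can be checked on each slice, where the
map is linear. -/
lemma measurable_received [NeZero M] [NeZero η] :
    Measurable (N.received : Sample M m lF η → Signal M m lF) := by
  refine measurable_from_prod_countable_right fun a => ?_
  simp only [received_eq]
  exact N.measurable_embbGain_noiseMap a

lemma measurable_interference [NeZero M] [NeZero η] :
    Measurable (N.interference : Sample M m lF η → Signal M m lF) := by
  refine measurable_from_prod_countable_right fun a => ?_
  simp only [interference_eq]
  exact (N.measurable_noiseMap a).comp measurable_snd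

lemma map_interference_cond [NeZero M] [NeZero η] {a : Activity M}
    (ha : N.law M m lF η (activity ⁻¹' {a}) ≠ 0) :
    (cond (N.law M m lF η) (activity ⁻¹' {a})).map N.interference
      = (N.disturbanceLaw M m lF η).map (N.noiseMap a) := by
  have e : (N.interference ∘ Prod.mk a :
      Signal M m lF × Signal M m lF × Signal M m lF × CableNoise M m lF η → Signal M m lF)
      = N.noiseMap a ∘ Prod.snd := by
    ext1 p
    exact N.interference_eq (a, p)
  rw [N.cond_law ha, Measure.map_map N.measurable_interference measurable_prodMk_left, e,
    ← Measure.map_map (N.measurable_noiseMap a) measurable_snd, Measure.map_snd_prod,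
    measure_univ, one_smul]

lemma mutualInfo_cond [NeZero M] [NeZero η] {a : Activity M}
    (ha : N.law M m lF η (activity ⁻¹' {a}) ≠ 0) :
    mutualInfo (cond (N.law M m lF η) (activity ⁻¹' {a})) N.received embb ≠ ⊤ ∧
    (mutualInfo (cond (N.law M m lF η) (activity ⁻¹' {a})) N.received embb).toReal
      = lF * Real.log (N.gainMatrix m η a).det := by
  set T : Signal M m lF → Signal M m lF := ((N.embbGain M m lF η).map ((↑) : ℝ → ℂ) *ᵥ ·)
  have hT : Measurable T := measurable_mulVec _
  have hn := N.measurable_noiseMap (m := m) (lF := lF) (η := η) a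
  have : IsProbabilityMeasure ((N.disturbanceLaw M m lF η).map (N.noiseMap a)) :=
    Measure.isProbabilityMeasure_map hn.aemeasurable
  have hemb : Measurable (embb : Sample M m lF η → Signal M m lF) :=
    measurable_fst.comp measurable_snd
  have hprod : ((N.embbLaw M m lF).prod (N.disturbanceLaw M m lF η)).map
      (Prod.map id (N.noiseMap a))
      = (N.embbLaw M m lF).prod ((N.disturbanceLaw M m lF η).map (N.noiseMap a)) := by
    rw [← Measure.map_prod_map _ _ measurable_id hn, Measure.map_id]
  have hpm : Measurable (Prod.map id (N.noiseMap a) :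
      Signal M m lF × Signal M m lF × Signal M m lF × CableNoise M m lF η → _) :=
    measurable_id.prodMap hn
  have hr : (cond (N.law M m lF η) (activity ⁻¹' {a})).map N.received
      = ((N.embbLaw M m lF).prod ((N.disturbanceLaw M m lF η).map (N.noiseMap a))).map
        fun p => T p.1 + p.2 := by
    rw [N.cond_law ha, Measure.map_map N.measurable_received measurable_prodMk_left, ← hprod,
      Measure.map_map (by fun_prop) hpm]
    congr 1
    ext1 p
    exact N.received_eq (a, p)
  have hx : (cond (N.law M m lF η) (activity ⁻¹' {a})).map embb = N.embbLaw M m lF := by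
    rw [N.cond_law ha, Measure.map_map hemb measurable_prodMk_left]
    change Measure.map Prod.fst _ = _
    rw [Measure.map_fst_prod, measure_univ, one_smul]
  have hj : (cond (N.law M m lF η) (activity ⁻¹' {a})).map (fun s => (N.received s, embb s))
      = ((N.embbLaw M m lF).prod ((N.disturbanceLaw M m lF η).map (N.noiseMap a))).map
        fun p => (T p.1 + p.2, p.1) := by
    rw [N.cond_law ha, Measure.map_map (N.measurable_received.prodMk hemb) measurable_prodMk_left,
      ← hprod, Measure.map_map (by fun_prop) hpm]
    congr 1
    ext1 p
    exact Prod.ext (N.received_eq (a, p)) rfl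
  have hR : (N.RA m η a).PosDef := N.posDef_RA a
  have hR' : (N.receivedCov m η a).PosDef := N.posDef_receivedCov a
  obtain ⟨h1, h2⟩ := IsComplexNormal.klDiv_map hT (hR.kronecker PosDef.one)
    (hR'.kronecker PosDef.one) (N.isComplexNormal_noise (m := m) (lF := lF) (η := η) a)
    (N.isComplexNormal_received a)
  rw [mutualInfo, hr, hx, hj]
  refine ⟨h1, ?_⟩
  -- The determinant of R ⊗ I is (det R)^lF; this is the source of the factor lF.
  rw [h2, det_gainMatrix, det_kronecker, det_kronecker, det_one, one_pow, mul_one, mul_one,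
    Fintype.card_fin, Real.log_pow, Real.log_pow, Real.log_div hR'.det_pos.ne' hR.det_pos.ne']
  ring

end Laws

/-! ### Averaging over activity patterns and normalization. -/

lemma condMutualInfo_received_embb [NeZero M] [NeZero η] :
    condMutualInfo (N.law M m lF η) N.received embb activity ≠ ⊤ ∧
    (condMutualInfo (N.law M m lF η) N.received embb activity).toReal
      = lF * ∫ a, Real.log (N.gainMatrix m η a).det ∂(N.activityLaw M) := by
  have h : ∀ a : Activity M, N.law M m lF η (activity ⁻¹' {a})
      * mutualInfo (cond (N.law M m lF η) (activity ⁻¹' {a})) N.received embb ≠ ⊤ ∧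
      (N.law M m lF η (activity ⁻¹' {a})
        * mutualInfo (cond (N.law M m lF η) (activity ⁻¹' {a})) N.received embb).toReal
        = (N.activityLaw M).real {a} * (lF * Real.log (N.gainMatrix m η a).det) := by
    intro a
    -- Null patterns occur when q is 0 or 1. Their weight kills the term on both sides, so nothing
    -- is needed about conditioning on them.
    by_cases ha : N.law M m lF η (activity ⁻¹' {a}) = 0
    · have ha' : (N.activityLaw M).real {a} = 0 := by
        rw [measureReal_def, ← N.law_activity_preimage (m := m) (lF := lF) (η := η), ha]
        rfl
      simp [ha, ha']
    · obtain ⟨h1, h2⟩ := N.mutualInfo_cond ha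
      rw [N.law_activity_preimage]
      refine ⟨ENNReal.mul_ne_top (measure_ne_top _ _) h1, ?_⟩
      rw [ENNReal.toReal_mul, h2]
      rfl
  refine ⟨ENNReal.sum_ne_top.2 fun a _ => (h a).1, ?_⟩
  rw [condMutualInfo, ENNReal.toReal_sum fun a _ => (h a).1,
    integral_fintype (μ := N.activityLaw M) .of_finite, Finset.mul_sum]
  refine Finset.sum_congr rfl fun a _ => ?_
  rw [(h a).2, smul_eq_mul]
  ring

end CRAN

theorem lemma4 (N : CRAN) (M m lF η : ℕ) [NeZero M] [NeZero m] [NeZero lF] [NeZero η] :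
    -- the matrices to be inverted are invertible and the determinants are positive
    (∀ a : Activity M, IsUnit (N.RA m η a).det ∧ 0 < (N.gainMatrix m η a).det) ∧
    -- given the activity pattern, noise plus interference is centred with covariance `R_A ⊗ I`
    (∀ a : Activity M,
      N.law M m lF η (CRAN.activity ⁻¹' {a}) ≠ 0 →
      ∀ r s : Res M m lF,
        ∫ ω, N.interference ω r ∂(cond (N.law M m lF η) (CRAN.activity ⁻¹' {a})) = 0 ∧
        Integrable (fun ω => N.interference ω r * star (N.interference ω s))
          (cond (N.law M m lF η) (CRAN.activity ⁻¹' {a})) ∧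
        ∫ ω, N.interference ω r * star (N.interference ω s)
            ∂(cond (N.law M m lF η) (CRAN.activity ⁻¹' {a}))
          = (((Matrix.kronecker (N.RA m η a) (1 : Matrix (Fin lF) (Fin lF) ℝ)) r s : ℝ) : ℂ)) ∧
    -- the rate
    N.rate M m lF η ≠ ⊤ ∧
    (N.rate M m lF η).toReal
      = mu m lF / M * ∫ a, Real.logb 2 (N.gainMatrix m η a).det ∂(N.activityLaw M) := by
  refine ⟨fun a => ⟨(N.posDef_RA a).det_pos.ne'.isUnit, N.det_gainMatrix_pos a⟩, ?_, ?_⟩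
  · intro a ha r s
    have hm := N.measurable_interference (M := M) (m := m) (lF := lF) (η := η)
    have := Measure.isProbabilityMeasure_map (μ := N.disturbanceLaw M m lF η)
      (N.measurable_noiseMap a).aemeasurable
    obtain ⟨h1, h2, h3⟩ := (N.isComplexNormal_noise (m := m) (lF := lF) (η := η) a).integral_mul_star
      ((N.posDef_RA a).kronecker Matrix.PosDef.one) r s
    have hc : Continuous fun z : Signal M m lF => z r * star (z s) := by fun_prop
    rw [← N.map_interference_cond ha] at h1 h2 h3
    rw [integral_map hm.aemeasurable (continuous_apply r).aestronglyMeasurable] at h1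
    rw [integrable_map_measure hc.aestronglyMeasurable hm.aemeasurable] at h2
    rw [integral_map hm.aemeasurable hc.aestronglyMeasurable] at h3
    exact ⟨h1, h2, h3⟩
  · obtain ⟨h1, h2⟩ := N.condMutualInfo_received_embb (M := M) (m := m) (lF := lF) (η := η)
    have hlog : 0 < Real.log 2 := Real.log_pos one_lt_two
    have hM : (M : ℝ) ≠ 0 := by exact_mod_cast NeZero.ne M
    have hn : nF m lF ≠ 0 := mul_ne_zero (NeZero.ne m) (NeZero.ne lF)
    constructor
    · refine ENNReal.div_ne_top (ENNReal.div_ne_top h1 (by simpa using hlog)) ?_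
      exact mul_ne_zero (by exact_mod_cast hn) (by exact_mod_cast NeZero.ne M)
    · rw [CRAN.rate, ENNReal.toReal_div, ENNReal.toReal_div, h2, ENNReal.toReal_ofReal hlog.le,
        ENNReal.toReal_mul, ENNReal.toReal_natCast, ENNReal.toReal_natCast]
      -- The factor lF over nF is μ, and dividing by log 2 converts nats to bits.
      simp only [Real.logb, integral_div, mu]
      field_simp
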